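/- **Setting.** Let $(T,\eta,\mu)$ be a finitary monad on $\mathsf{Set}$ (finitary: the functor preserves filtered colimits) such that in the category $\mathsf{Set}^T$ of Eilenberg–Moore algebras finitely generated algebras (quotients of free algebras on finite sets) are closed under taking kernel pairs. Let $F:\mathsf{Set}\to\mathsf{Set}$ be a finitary functor that weakly preserves pullbacks and has a lifting $\bar F:\mathsf{Set}^T\to\mathsf{Set}^T$, that is, $U\bar F=FU$ for the forgetful functor $U:\mathsf{Set}^T\to\mathsf{Set}$. For an endofunctor $G$ of a category $\mathcal A$, let $\mathsf{Coalg}(G)$ be the category of coalgebras $c:C\to GC$, and $\mathsf{Coalg}_f(G)$ its full subcategory of coalgebras with finitely presentable carrier. A coalgebra $(S,s)$ is *locally finitely presentable* if the forgetful functor $\mathsf{Coalg}_f(G)/(S,s)\to\mathcal A_{fp}/S$ is cofinal, where $\mathcal A_{fp}$ is the full subcategory of finitely presentable objects. Write $\nu G$ for a final $G$-coalgebra and $\rho G$ for a final object among the locally finitely presentable $G$-coalgebras. For an $FT$-coalgebra $c:C\to FTC$, let $c^\sharp:TC\to FTC$ be the unique $T$-algebra homomorphism from $(TC,\mu_C)$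 to $\bar F(TC,\mu_C)$ with $c^\sharp\cdot\eta_C=c$. The *coalgebraic language map* of $(C,c)$ is $\ell_c=h\cdot\eta_C:C\to\nu F$, where $h$ is the unique $F$-coalgebra homomorphism from $(TC,c^\sharp)$ to $\nu F$. **Theorem.** The coalgebras $\nu F$, $\rho(FT)$ and $\rho\bar F$ exist, and the structure map $r:\rho(FT)\to FT(\rho(FT))$ is a bijection. Let $\beta=r^{-1}\cdot r^\sharp:T(\rho(FT))\to\rho(FT)$; this is the unique $T$-algebra structure for which $r$ is a homomorphism to $\bar F(T(\rho(FT)),\mu_{\rho(FT)})$, and it makes $(\rho(FT),F\beta\cdot r)$ an $\bar F$-coalgebra. There is exactly one $\bar F$-coalgebra homomorphism $q:(\rho(FT),F\beta\cdot r)\to\rho\bar F$, and it is surjective. For every expression calculus, that is, for every set $\mathrm{Exp}$ with a surjective map $q_0:\mathrm{Exp}\to\rho(FT)$, the coalgebra $\rho\bar F$ together with the map $q\cdot q_0:\mathrm{Exp}\to\rho\bar F$ is complete: if $E,E'\in\mathrm{Exp}$ have the same language semantics, $\ell_r(q_0(E))=\ell_r(q_0(E'))$ in $\nu F$, then $q(q_0(E))=q(q_0(E'))$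 in $\rho\bar F$. -/

import Mathlib

open CategoryTheory CategoryTheory.Limits CategoryTheory.Endofunctor

universe w v u

/-! ### Locally finitely presentable coalgebras -/

section LFP

/-- `Coalg_f(G)`: the full subcategory of `Coalg(G)` of the coalgebras whose carrier is a finitely
presentable object. -/
abbrev CoalgFP {A : Type w} [Category.{v} A] (G : A ⥤ A) : ObjectProperty (Coalgebra G) :=
  fun P => IsFinitelyPresentable.{v} P.V

/-- The canonical forgetful functor `Coalg_f(G) / (S, s) ⥤ A_fp / S`. -/
def CoalgFP.forgetOver {A : Type w} [Category.{v} A] {G : A ⥤ A} (S : Coalgebra G) :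
    CostructuredArrow (CoalgFP G).ι S ⥤
      CostructuredArrow (ObjectProperty.isFinitelyPresentable.{v} A).ι S.V where
  obj P :=
    let Y : (ObjectProperty.isFinitelyPresentable.{v} A).FullSubcategory :=
      ⟨P.left.obj.V, P.left.property⟩
    let f : P.left.obj.V ⟶ S.V := Coalgebra.Hom.f P.hom
    CostructuredArrow.mk (S := (ObjectProperty.isFinitelyPresentable.{v} A).ι) (Y := Y) f
  map {P Q} l :=
    let k : P.left.obj.V ⟶ Q.left.obj.V := l.left.hom.f
    CostructuredArrow.homMk (ObjectProperty.homMk k)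
      (congrArg Coalgebra.Hom.f (CostructuredArrow.w l))

/-- A coalgebra `(S, s)` is locally finitely presentable if the forgetful functor
`Coalg_f(G) / (S, s) ⥤ A_fp / S` is cofinal (called `Final` in Mathlib). -/
def IsLFPCoalgebra {A : Type w} [Category.{v} A] {G : A ⥤ A} (S : Coalgebra G) : Prop :=
  (CoalgFP.forgetOver S).Final

/-- `R` is a final locally finitely presentable coalgebra (a rational fixpoint `ρG`): it is locally
finitely presentable, and every locally finitely presentable coalgebra has exactly one homomorphism
to it. -/
structure IsRationalFixpoint {A : Type w} [Category.{v} A] {G : A ⥤ A} (R : Coalgebra G) :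
    Prop where
  lfp : IsLFPCoalgebra R
  final : ∀ C : Coalgebra G, IsLFPCoalgebra C → ∃ h : C ⟶ R, ∀ h' : C ⟶ R, h' = h

end LFP

/-! ### Assumptions on the functor and on the monad -/

/-- `F` weakly preserves pullbacks: it sends every pullback square to a weak pullback square (a
commutative square with the existence, but perhaps not the uniqueness, part of the universal
property). -/
def WeaklyPreservesPullbacks {A : Type w} [Category.{v} A] (F : A ⥤ A) : Prop :=
  ∀ ⦃P X Y Z : A⦄ (p : P ⟶ X) (q : P ⟶ Y) (f : X ⟶ Z) (g : Y ⟶ Z), IsPullback p q f g →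
    ∀ ⦃W : A⦄ (h : W ⟶ F.obj X) (k : W ⟶ F.obj Y), h ≫ F.map f = k ≫ F.map g →
      ∃ l : W ⟶ F.obj P, l ≫ F.map p = h ∧ l ≫ F.map q = k

/-- A `T`-algebra is finitely generated if it is a quotient of the free algebra on a finite set. -/
def IsFGAlgebra {T : CategoryTheory.Monad (Type u)} (A : T.Algebra) : Prop :=
  ∃ (X : Type u) (_ : Finite X) (e : T.free.obj X ⟶ A), Function.Surjective e.f

/-- Finitely generated `T`-algebras are closed under taking kernel pairs: if `A` is finitely
generated and `a, b : K ⟶ A` is a kernel pair of a homomorphism `A ⟶ B`, then `K` is finitely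
generated. -/
def FGClosedUnderKernelPairs (T : CategoryTheory.Monad (Type u)) : Prop :=
  ∀ ⦃A B K : T.Algebra⦄ (f : A ⟶ B) (a b : K ⟶ A),
    IsKernelPair f a b → IsFGAlgebra A → IsFGAlgebra K

/-! ### Liftings of a functor to Eilenberg-Moore algebras -/

/-- A lifting of `F` to the category of `T`-algebras: each `T`-algebra `A` is assigned a
`T`-algebra structure on the set `F A`, such that `F h` is a homomorphism for every homomorphism
`h`. See `Lifting.functor` and `Lifting.exists_functor_eq`: these are exactly the functors
`G : T.Algebra ⥤ T.Algebra` with `G ⋙ T.forget = T.forget ⋙ F`. -/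
structure Lifting (T : CategoryTheory.Monad (Type u)) (F : Type u ⥤ Type u) where
  str : ∀ A : T.Algebra, T.obj (F.obj A.A) ⟶ F.obj A.A
  unit : ∀ A : T.Algebra, T.η.app (F.obj A.A) ≫ str A = 𝟙 (F.obj A.A)
  assoc : ∀ A : T.Algebra, T.μ.app (F.obj A.A) ≫ str A = T.map (str A) ≫ str A
  map_hom : ∀ {A B : T.Algebra} (f : A ⟶ B), T.map (F.map f.f) ≫ str B = str A ≫ F.map f.f

namespace Lifting

/-- The lifted functor `F̄ : Set^T ⥤ Set^T`. -/
def functor {T : CategoryTheory.Monad (Type u)} {F : Type u ⥤ Type u} (L : Lifting T F) :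
    T.Algebra ⥤ T.Algebra where
  obj A := { A := F.obj A.A, a := L.str A, unit := L.unit A, assoc := L.assoc A }
  map f := { f := F.map f.f, h := L.map_hom f }

theorem functor_forget {T : CategoryTheory.Monad (Type u)} {F : Type u ⥤ Type u}
    (L : Lifting T F) : L.functor ⋙ T.forget = T.forget ⋙ F := rfl

theorem exists_functor_eq {T : CategoryTheory.Monad (Type u)} {F : Type u ⥤ Type u}
    (G : T.Algebra ⥤ T.Algebra) (hG : G ⋙ T.forget = T.forget ⋙ F) :
    ∃ L : Lifting T F, L.functor = G := by
  have hobj : ∀ A : T.Algebra, (G.obj A).A = F.obj A.A := fun A => Functor.congr_obj hG A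
  have hmap : ∀ {A B : T.Algebra} (f : A ⟶ B), (G.map f).f =
      eqToHom (hobj A) ≫ F.map f.f ≫ eqToHom (hobj B).symm := fun f => Functor.congr_hom hG f
  have key : ∀ (B : T.Algebra) (X : Type u) (e : B.A = X),
      ∃ (u : T.η.app X ≫ (T.map (eqToHom e.symm) ≫ B.a ≫ eqToHom e) = 𝟙 X)
        (v : T.μ.app X ≫ (T.map (eqToHom e.symm) ≫ B.a ≫ eqToHom e) =
          T.map (T.map (eqToHom e.symm) ≫ B.a ≫ eqToHom e) ≫
            (T.map (eqToHom e.symm) ≫ B.a ≫ eqToHom e)),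
        (⟨X, T.map (eqToHom e.symm) ≫ B.a ≫ eqToHom e, u, v⟩ : T.Algebra) = B := by
    rintro B X rfl
    exact ⟨by simp [B.unit], by simp [B.assoc], by simp⟩
  refine ⟨⟨fun A => T.map (eqToHom (hobj A).symm) ≫ (G.obj A).a ≫ eqToHom (hobj A),
    fun A => (key _ _ (hobj A)).1, fun A => (key _ _ (hobj A)).2.1, fun {A B} f => ?_⟩, ?_⟩
  · have h1 := (G.map f).h
    rw [hmap] at h1
    have h2 : F.map f.f = eqToHom (hobj A).symm ≫
      (eqToHom (hobj A) ≫ F.map f.f ≫ eqToHom (hobj B).symm) ≫ eqToHom (hobj B) := by simp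
    simp only [Functor.map_comp, Category.assoc] at h1 ⊢
    rw [← cancel_epi (T.map (eqToHom (hobj A))), ← cancel_mono (eqToHom (hobj B).symm)]
    simpa [eqToHom_map] using h1
  · refine CategoryTheory.Functor.ext (fun A => (key _ _ (hobj A)).2.2) (fun A B f => ?_)
    apply T.forget.map_injective
    have eh : ∀ {X A B Y : T.Algebra} (e : X = A) (g : A ⟶ B) (e' : B = Y),
        (eqToHom e ≫ g ≫ eqToHom e').f =
          eqToHom (congrArg _ e) ≫ g.f ≫ eqToHom (congrArg _ e') := by
      rintro X _ B _ rfl g rfl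
      simp
    have h : F.map f.f = eqToHom (hobj A).symm ≫ (G.map f).f ≫ eqToHom (hobj B) := by
      simp [hmap]
    exact h.trans (eh (key _ _ (hobj A)).2.2 (G.map f) (key _ _ (hobj B)).2.2.symm).symm

/-- The algebra structure of `F̄TX`, the image under the lifting of the free algebra on `X`. -/
def freeStr {T : CategoryTheory.Monad (Type u)} {F : Type u ⥤ Type u} (L : Lifting T F) (X : Type u) :
    T.obj (F.obj (T.obj X)) ⟶ F.obj (T.obj X) :=
  L.str (T.free.obj X)

theorem unit_freeStr {T : CategoryTheory.Monad (Type u)} {F : Type u ⥤ Type u} (L : Lifting T F)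
    (X : Type u) : T.η.app (F.obj (T.obj X)) ≫ L.freeStr X = 𝟙 (F.obj (T.obj X)) :=
  L.unit (T.free.obj X)

theorem assoc_freeStr {T : CategoryTheory.Monad (Type u)} {F : Type u ⥤ Type u} (L : Lifting T F)
    (X : Type u) : T.μ.app (F.obj (T.obj X)) ≫ L.freeStr X = T.map (L.freeStr X) ≫ L.freeStr X :=
  L.assoc (T.free.obj X)

/-- The extension `c♯ = α ∘ Tc : TX ⟶ FTX` of a map `c : X ⟶ FTX`, where `α` is the algebra
structure of `F̄TX`. It is the unique homomorphism `TX ⟶ F̄TX` extending `c`. -/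
def ext {T : CategoryTheory.Monad (Type u)} {F : Type u ⥤ Type u} (L : Lifting T F)
    {X : Type u} (c : X ⟶ F.obj (T.obj X)) : T.obj X ⟶ F.obj (T.obj X) :=
  T.map c ≫ L.freeStr X

theorem map_ext {T : CategoryTheory.Monad (Type u)} {F : Type u ⥤ Type u} (L : Lifting T F)
    {X : Type u} (c : X ⟶ F.obj (T.obj X)) :
    T.map (L.ext c) ≫ L.freeStr X = T.μ.app X ≫ L.ext c := by
  have h2 : T.map (T.map c) ≫ T.μ.app (F.obj (T.obj X)) = T.μ.app X ≫ T.map c := T.μ.naturality c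
  rw [ext, Functor.map_comp, Category.assoc, ← L.assoc_freeStr, ← Category.assoc, h2,
    Category.assoc]

theorem unit_ext {T : CategoryTheory.Monad (Type u)} {F : Type u ⥤ Type u} (L : Lifting T F)
    {X : Type u} (c : X ⟶ F.obj (T.obj X)) : T.η.app X ≫ L.ext c = c := by
  have h2 : c ≫ T.η.app (F.obj (T.obj X)) = T.η.app X ≫ T.map c := T.η.naturality c
  rw [ext, ← Category.assoc, ← h2, Category.assoc, L.unit_freeStr, Category.comp_id]

/-- The generalised powerset construction: an `FT`-coalgebra `c : C ⟶ FTC` yields the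
`F̄`-coalgebra `c♯ : TC ⟶ F̄TC` on the free algebra. -/
def det {T : CategoryTheory.Monad (Type u)} {F : Type u ⥤ Type u} (L : Lifting T F)
    (C : Coalgebra (T.toFunctor ⋙ F)) : Coalgebra L.functor where
  V := T.free.obj C.V
  str := { f := L.ext (X := C.V) C.str, h := L.map_ext (X := C.V) C.str }

/-- The `F`-coalgebra underlying an `F̄`-coalgebra. -/
def underlying {T : CategoryTheory.Monad (Type u)} {F : Type u ⥤ Type u} (L : Lifting T F)
    (D : Coalgebra L.functor) : Coalgebra F where
  V := D.V.A
  str := D.str.f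

/-- The coalgebraic language map `C ⟶ νF` of an `FT`-coalgebra `C`: the unit `C ⟶ TC` followed by
the unique `F`-coalgebra homomorphism from `(TC, c♯)` to the final `F`-coalgebra `Z = νF`. -/
def lang {T : CategoryTheory.Monad (Type u)} {F : Type u ⥤ Type u} (L : Lifting T F)
    {Z : Coalgebra F} (hZ : IsTerminal Z) (C : Coalgebra (T.toFunctor ⋙ F)) : C.V ⟶ Z.V :=
  T.η.app C.V ≫ (hZ.from (L.underlying (L.det C))).f

/-- The `T`-algebra structure `γ = c⁻¹ ∘ c♯ : TX ⟶ X` on a set `X` with a bijection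
`c : X ≅ FTX`, the unique one for which `c` is a homomorphism to `F̄TX`. -/
def algebraOfIso {T : CategoryTheory.Monad (Type u)} {F : Type u ⥤ Type u} (L : Lifting T F)
    {X : Type u} (c : X ≅ F.obj (T.obj X)) : T.Algebra where
  A := X
  a := L.ext c.hom ≫ c.inv
  unit := by rw [← Category.assoc, L.unit_ext, c.hom_inv_id]
  assoc := by
    have h : T.map (L.ext c.hom ≫ c.inv) ≫ L.ext c.hom = T.map (L.ext c.hom) ≫ L.freeStr X := by
      rw [ext, ← Category.assoc (T.map _) (T.map _), ← Functor.map_comp, Category.assoc _ c.inv,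
        c.inv_hom_id, Category.comp_id]
    rw [← Category.assoc, ← Category.assoc, h, L.map_ext]

theorem algebraOfIso_hom {T : CategoryTheory.Monad (Type u)} {F : Type u ⥤ Type u}
    (L : Lifting T F) {X : Type u} (c : X ≅ F.obj (T.obj X)) :
    T.map c.hom ≫ L.freeStr X = (L.algebraOfIso c).a ≫ c.hom :=
  ((Category.assoc _ _ _).trans
    ((congrArg (L.ext c.hom ≫ ·) c.inv_hom_id).trans (Category.comp_id _))).symm

/-- The `F̄`-coalgebra `Fγ ∘ c : X ⟶ FX` on the algebra `(X, γ)` given by a bijection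
`c : X ≅ FTX`. -/
def coalgebraOfIso {T : CategoryTheory.Monad (Type u)} {F : Type u ⥤ Type u} (L : Lifting T F)
    {X : Type u} (c : X ≅ F.obj (T.obj X)) : Coalgebra L.functor where
  V := L.algebraOfIso c
  str :=
    let γ : T.free.obj X ⟶ L.algebraOfIso c :=
      { f := (L.algebraOfIso c).a, h := (L.algebraOfIso c).assoc.symm }
    let c' : L.algebraOfIso c ⟶ L.functor.obj (T.free.obj X) :=
      { f := c.hom, h := L.algebraOfIso_hom c }
    c' ≫ L.functor.map γ

/-- A fixpoint `c : C ≅ FTC` of `FT` as an `F̄`-coalgebra. -/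
noncomputable def fixpointCoalgebra {T : CategoryTheory.Monad (Type u)} {F : Type u ⥤ Type u}
    (L : Lifting T F) (C : Coalgebra (T.toFunctor ⋙ F)) [IsIso C.str] : Coalgebra L.functor :=
  L.coalgebraOfIso (X := C.V) (asIso C.str)

/-- The language semantics of expressions: `q₀ : Exp → ρ(FT)` followed by the coalgebraic language
map of `R = ρ(FT)`. -/
def sem {T : CategoryTheory.Monad (Type u)} {F : Type u ⥤ Type u} (L : Lifting T F)
    {Z : Coalgebra F} (hZ : IsTerminal Z) (R : Coalgebra (T.toFunctor ⋙ F))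
    {Exp : Type v} (q₀ : Exp → R.V) (E : Exp) : Z.V :=
  L.lang hZ R (q₀ E)

/-- An `F̄`-coalgebra `D` with a map `f : Exp → D` is complete if `f` identifies any two expressions
with the same language semantics. -/
def IsComplete {T : CategoryTheory.Monad (Type u)} {F : Type u ⥤ Type u} (L : Lifting T F)
    {Z : Coalgebra F} (hZ : IsTerminal Z) (R : Coalgebra (T.toFunctor ⋙ F))
    {Exp : Type v} (q₀ : Exp → R.V) (D : Coalgebra L.functor) (f : Exp → D.V.A) : Prop :=
  ∀ E E' : Exp, L.sem hZ R q₀ E = L.sem hZ R q₀ E' → f E = f E'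

end Lifting

/-! ### Finitary endofunctors of the category of types -/

section FinitaryFunctors

/-! Everything is compared inside `νF`. By finality, `νF` carries a `T`-algebra structure making it
a final `F̄`-coalgebra (`finalAlgebra`, `behaviour`, `hom_finalCoalgebra_ext`). Weak preservation of
pullbacks makes `F` preserve injections, so images of coalgebra homomorphisms are subcoalgebras.

The kernel pair condition makes finitely generated algebras finitely presentable, so the image of a
determinisation `TX`, with `X` a finite `FT`-coalgebra, has finitely presentable carrier.
Conversely, every coalgebra with finitely presentable carrier is a quotient of such a `TX`
(`exists_det_cover`). Hence `ρF̄` is the subcoalgebra of `νF` on `rationalSet`, the set of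
behaviours of all these `TX` (`exists_rationalFixpoint`). Likewise `ρ(FT)` is the union in `ν(FT)`
of the images of finite coalgebras (`exists_rationalFixpoint_type`).

The behaviour of `ρ(FT)`, viewed as an `F̄`-coalgebra, is its language map
(`behaviour_fixpointCoalgebra`). It takes values in `rationalSet`, so it factors as `q` followed by
the injection of `ρF̄` into `νF`. That injectivity is completeness; surjectivity of `q` holds
because each finite `X` maps to `ρ(FT)`. -/

theorem exists_finite_support (F : Type u ⥤ Type u) [PreservesFilteredColimits F] {X : Type u}
    (x : F.obj X) : ∃ (n : ℕ) (v : ULift.{u} (Fin n) ⟶ X) (a : F.obj (ULift.{u} (Fin n))),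
      F.map v a = x := by
  -- `X` is the filtered colimit of its finite subsets, and `F` preserves this colimit.
  have := HasCardinalLT.Set.isFiltered_of_aleph0_le X Cardinal.aleph0.{u} le_rfl
  obtain ⟨⟨A, hA⟩, a, ha⟩ := Types.jointly_surjective_of_isColimit
    (isColimitOfPreserves F (HasCardinalLT.Set.isColimitCocone X Cardinal.aleph0.{u} le_rfl)) x
  rw [hasCardinalLT_aleph0_iff] at hA
  obtain ⟨n, ⟨e⟩⟩ := Finite.exists_equiv_fin A
  let g : (ULift.{u} (Fin n) : Type u) ≅ (A : Type u) := (Equiv.ulift.trans e.symm).toIso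
  let a' : F.obj (A : Type u) := a
  have key : F.map (g.hom ≫ ↾(Subtype.val : A → X)) (F.map g.inv a') =
      F.map (↾(Subtype.val : A → X)) a' := by
    rw [← ConcreteCategory.comp_apply, ← F.map_comp, g.inv_hom_id_assoc]
  exact ⟨n, g.hom ≫ ↾(Subtype.val : A → X), F.map g.inv a', key.trans ha⟩

/-- A finitary functor is a quotient of a polynomial functor. -/
noncomputable abbrev finitaryQPF (F : Type u ⥤ Type u) [PreservesFilteredColimits F] :
    QPF F.obj where
  map f := F.map (↾f)
  P := ⟨Σ n : ℕ, F.obj (ULift.{u} (Fin n)), fun a => ULift.{u} (Fin a.1)⟩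
  abs p := F.map (↾p.2) p.1.2
  repr x := ⟨⟨(exists_finite_support F x).choose,
    (exists_finite_support F x).choose_spec.choose_spec.choose⟩,
    (exists_finite_support F x).choose_spec.choose⟩
  abs_repr x := (exists_finite_support F x).choose_spec.choose_spec.choose_spec
  abs_map f p := ConcreteCategory.congr_hom (F.map_comp (↾p.2) (↾f)) p.1.2

theorem exists_isTerminal_coalgebra (F : Type u ⥤ Type u) [PreservesFilteredColimits F] :
    ∃ Z : Coalgebra F, Nonempty (IsTerminal Z) := by
  let := finitaryQPF F
  let Z : Coalgebra F := { V := QPF.Cofix F.obj, str := ↾QPF.Cofix.dest }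
  have hc : ∀ {C : Coalgebra F} (h : C ⟶ Z) (x : C.V),
      Z.str (h.f x) = F.map h.f (C.str x) := fun h x =>
    (ConcreteCategory.congr_hom h.h x).symm
  refine ⟨Z, ⟨IsTerminal.ofUniqueHom (fun C =>
    { f := ↾(QPF.Cofix.corec (F := F.obj) C.str)
      h := ?_ }) (fun C m => ?_)⟩⟩
  · ext x
    exact (QPF.Cofix.dest_corec (F := F.obj) C.str x).symm
  · have key : ∀ (h k : C ⟶ Z), h = k := by
      intro h k
      apply Coalgebra.ext
      ext x
      -- Two homomorphisms with the same domain span a bisimulation: the quotient by the pairs `(h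
      -- x, k x)` equalises them.
      refine QPF.Cofix.bisim_rel (F := F.obj) (fun y z => ∃ x, h.f x = y ∧ k.f x = z) ?_ _ _
        ⟨x, rfl, rfl⟩
      rintro _ _ ⟨x, rfl, rfl⟩
      let π := Quot.mk fun y z => ∃ x, h.f x = y ∧ k.f x = z
      have hπ : h.f ≫ ↾π = k.f ≫ ↾π := by
        ext y
        exact Quot.sound ⟨y, rfl, rfl⟩
      change F.map (↾π) (Z.str (h.f x)) = F.map (↾π) (Z.str (k.f x))
      rw [hc, hc, ← F.map_comp_apply, ← F.map_comp_apply, hπ]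
    exact key _ _

/-- A monomorphism has the identity as its kernel pair; a weak factorisation through the image of
that square equals both of the maps being compared. -/
theorem WeaklyPreservesPullbacks.map_injective {F : Type u ⥤ Type u}
    (h : WeaklyPreservesPullbacks F) {X Y : Type u} (f : X ⟶ Y) (hf : Function.Injective f) :
    Function.Injective (F.map f) := by
  have : Mono f := (mono_iff_injective f).2 hf
  rw [← mono_iff_injective]
  refine ⟨fun a b hab => ?_⟩
  obtain ⟨l, h₁, h₂⟩ := h (𝟙 X) (𝟙 X) f f (IsKernelPair.id_of_mono f) a b hab
  exact h₁.symm.trans h₂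

/-- A map `g` extending the unit along `f` yields the retraction `T g ≫ μ` of `T f`. For nonempty
`X` it comes from a retraction of `f`; for empty `X`, any element of `T X` gives a constant `g`, and
if there is none the claim is trivial. -/
theorem CategoryTheory.Monad.map_injective (T : CategoryTheory.Monad (Type u)) {X Y : Type u}
    (f : X ⟶ Y) (hf : Function.Injective f) : Function.Injective (T.map f) := by
  have key : ∀ g : Y ⟶ T.obj X, f ≫ g = T.η.app X → Function.Injective (T.map f) := by
    intro g hg
    refine Function.LeftInverse.injective (g := T.map g ≫ T.μ.app X) fun t => ?_
    rw [← ConcreteCategory.comp_apply, ← Category.assoc, ← T.map_comp, hg, T.right_unit]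
    rfl
  rcases isEmpty_or_nonempty X with hX | hX
  · rcases isEmpty_or_nonempty (T.obj X) with hT | ⟨⟨t⟩⟩
    · exact Function.injective_of_subsingleton _
    · exact key (↾fun _ => t) (by ext x; exact hX.elim x)
  · refine key (↾(Function.invFun f) ≫ T.η.app X) ?_
    ext x
    exact congrArg (T.η.app X) (Function.leftInverse_invFun hf x)

theorem map_surjective_of_surjective (F : Type u ⥤ Type u) {X Y : Type u}
    (f : X ⟶ Y) (hf : Function.Surjective f) : Function.Surjective (F.map f) := by
  have : Epi f := (epi_iff_surjective f).2 hf
  have : IsSplitEpi f := isSplitEpi_of_epi f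
  exact (epi_iff_surjective _).1 inferInstance

theorem finite_iff_isFinitelyPresentable (X : Type u) :
    IsFinitelyPresentable.{u} X ↔ Finite X := by
  have : Fact Cardinal.aleph0.{u}.IsRegular := Cardinal.fact_isRegular_aleph0
  rw [← hasCardinalLT_aleph0_iff.{u}]
  exact Types.isCardinalPresentable_iff _

end FinitaryFunctors

/-! ### Locally finitely presentable coalgebras and rational fixpoints -/

section RationalFixpoints

variable {A : Type w} [Category.{v} A] {G : A ⥤ A}

/-- Locally finitely presentable coalgebras: a map from a finitely presentable object factors
through a homomorphism from a coalgebra with finitely presentable carrier. -/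
theorem IsLFPCoalgebra.exists_factor {S : Coalgebra G} (hS : IsLFPCoalgebra S) {X : A}
    (hX : IsFinitelyPresentable.{v} X) (f : X ⟶ S.V) :
    ∃ (P : Coalgebra G) (_ : IsFinitelyPresentable.{v} P.V) (h : P ⟶ S) (g : X ⟶ P.V),
      g ≫ h.f = f := by
  let X' : (ObjectProperty.isFinitelyPresentable.{v} A).FullSubcategory := ⟨X, hX⟩
  let d := CostructuredArrow.mk (S := (ObjectProperty.isFinitelyPresentable.{v} A).ι)
    (Y := X') f
  obtain ⟨s⟩ : Nonempty (StructuredArrow d (CoalgFP.forgetOver S)) := (hS.out d).is_nonempty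
  exact ⟨s.right.left.obj, s.right.left.property, s.right.hom, s.hom.left.hom,
    CostructuredArrow.w s.hom⟩

/-- The first condition makes the relevant comma categories nonempty and the second makes them
connected. Since `m` is monic, the two factorisations through `D` of the given map agree, so both
objects map to a single one. -/
theorem isLFPCoalgebra_of_directed (S : Coalgebra G)
    (h₁ : ∀ (X : A) (_ : IsFinitelyPresentable.{v} X) (f : X ⟶ S.V),
      ∃ (P : Coalgebra G) (_ : IsFinitelyPresentable.{v} P.V) (h : P ⟶ S) (g : X ⟶ P.V),
        g ≫ h.f = f)
    (h₂ : ∀ (P Q : Coalgebra G) (_ : IsFinitelyPresentable.{v} P.V)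
      (_ : IsFinitelyPresentable.{v} Q.V) (h : P ⟶ S) (k : Q ⟶ S),
      ∃ (D : Coalgebra G) (_ : IsFinitelyPresentable.{v} D.V) (m : D ⟶ S) (_ : Mono m.f)
        (h' : P ⟶ D) (k' : Q ⟶ D), h' ≫ m = h ∧ k' ≫ m = k) :
    IsLFPCoalgebra S := by
  refine ⟨fun d => ?_⟩
  obtain ⟨P, hP, h, g, hg⟩ := h₁ d.left.obj d.left.property d.hom
  let mk' (P : Coalgebra G) (hP : IsFinitelyPresentable.{v} P.V) (h : P ⟶ S)
      (g : d.left.obj ⟶ P.V) (hg : g ≫ h.f = d.hom) :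
      StructuredArrow d (CoalgFP.forgetOver S) :=
    StructuredArrow.mk (Y := CostructuredArrow.mk (S := (CoalgFP G).ι)
      (Y := (⟨P, hP⟩ : (CoalgFP G).FullSubcategory)) h)
      (CostructuredArrow.homMk (ObjectProperty.homMk g) hg)
  have : Nonempty (StructuredArrow d (CoalgFP.forgetOver S)) := ⟨mk' P hP h g hg⟩
  have comp_fac : ∀ (s : StructuredArrow d (CoalgFP.forgetOver S)) {D : Coalgebra G} (m : D ⟶ S)
      (l : s.right.left.obj ⟶ D), l ≫ m = s.right.hom →
      ((show d.left.obj ⟶ s.right.left.obj.V from s.hom.left.hom) ≫ l.f) ≫ m.f = d.hom := by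
    intro s D m l hl
    refine (Category.assoc _ _ _).trans (Eq.trans ?_ (CostructuredArrow.w s.hom))
    exact congrArg ((show d.left.obj ⟶ s.right.left.obj.V from s.hom.left.hom) ≫ ·)
      (congrArg Coalgebra.Hom.f hl)
  have hom : ∀ (s : StructuredArrow d (CoalgFP.forgetOver S)) (D : Coalgebra G)
      (hD : IsFinitelyPresentable.{v} D.V) (m : D ⟶ S) (g' : d.left.obj ⟶ D.V)
      (hg' : g' ≫ m.f = d.hom) (_ : Mono m.f) (l : s.right.left.obj ⟶ D),
      l ≫ m = s.right.hom → Nonempty (s ⟶ mk' D hD m g' hg') := by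
    intro s D hD m g' hg' _ l hl
    refine ⟨StructuredArrow.homMk (CostructuredArrow.homMk (ObjectProperty.homMk l) hl) ?_⟩
    ext
    exact (cancel_mono m.f).1 ((comp_fac s m l hl).trans hg'.symm)
  refine zigzag_isConnected fun s t => ?_
  obtain ⟨D, hD, m, hm, h', k', hh, hk⟩ :=
    h₂ _ _ s.right.left.property t.right.left.property s.right.hom t.right.hom
  have hw := comp_fac s m h' hh
  obtain ⟨a⟩ := hom s D hD m _ hw hm h' hh
  obtain ⟨b⟩ := hom t D hD m _ hw hm k' hk
  exact (Zigzag.of_hom a).trans (Zigzag.of_inv b)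

theorem IsRationalFixpoint.hom_ext {R C : Coalgebra G} (hR : IsRationalFixpoint R)
    (hC : IsLFPCoalgebra C) (f g : C ⟶ R) : f = g := by
  obtain ⟨h, hh⟩ := hR.final C hC
  rw [hh f, hh g]

theorem IsRationalFixpoint.nonempty_iso {R R' : Coalgebra G} (hR : IsRationalFixpoint R)
    (hR' : IsRationalFixpoint R') : Nonempty (R ≅ R') := by
  obtain ⟨f, -⟩ := hR'.final R hR.lfp
  obtain ⟨g, -⟩ := hR.final R' hR'.lfp
  exact ⟨⟨f, g, hR.hom_ext hR.lfp _ _, hR'.hom_ext hR'.lfp _ _⟩⟩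

/-- Corestriction of a coalgebra homomorphism along a subcoalgebra. -/
def coalgebraLift {P D S : Coalgebra G} (h : P ⟶ S) (m : D ⟶ S) (hm : Mono (G.map m.f))
    (g : P.V ⟶ D.V) (hg : g ≫ m.f = h.f) : P ⟶ D where
  f := g
  h := by
    rw [← cancel_mono (G.map m.f), Category.assoc, ← G.map_comp, hg, h.h, ← hg,
      Category.assoc, Category.assoc, m.h]

theorem coalgebraLift_comp {P D S : Coalgebra G} (h : P ⟶ S) (m : D ⟶ S)
    (hm : Mono (G.map m.f)) (g : P.V ⟶ D.V) (hg : g ≫ m.f = h.f) :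
    coalgebraLift h m hm g hg ≫ m = h :=
  Coalgebra.ext hg

end RationalFixpoints

/-! ### The rational fixpoint of a finitary endofunctor of the category of types -/

section CoalgebrasInTypes

variable {G : Type u ⥤ Type u}

theorem exists_lift_of_range_subset {X Y Z : Type u} (f : X ⟶ Z) (j : Y ⟶ Z)
    (h : ∀ x, ∃ y, j y = f x) : ∃ g : X ⟶ Y, g ≫ j = f := by
  choose g hg using h
  exact ⟨↾g, by ext x; exact hg x⟩

theorem coalgebraHom_apply {C D : Coalgebra G} (h : C ⟶ D) (x : C.V) :
    D.str (h.f x) = G.map h.f (C.str x) :=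
  (ConcreteCategory.congr_hom h.h x).symm

/-- The coproduct of a family of coalgebras. -/
def sigmaCoalgebra {ι : Type u} (C : ι → Coalgebra G) : Coalgebra G where
  V := Σ i, (C i).V
  str := ↾fun x => G.map (↾fun y : (C x.1).V => (⟨x.1, y⟩ : Σ i, (C i).V)) ((C x.1).str x.2)

/-- The coprojections of the coproduct of a family of coalgebras. -/
def sigmaCoalgebraι {ι : Type u} (C : ι → Coalgebra G) (i : ι) : C i ⟶ sigmaCoalgebra C where
  f := ↾fun x : (C i).V => (⟨i, x⟩ : Σ i, (C i).V)
  h := by ext x; rfl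

theorem finite_sigmaCoalgebra {ι : Type u} [Finite ι] (C : ι → Coalgebra G)
    (hC : ∀ i, Finite (C i).V) : Finite (sigmaCoalgebra C).V :=
  inferInstanceAs (Finite (Σ i, (C i).V))

theorem exists_finite_coalgebra_pair (P Q : Coalgebra G) (hP : Finite P.V) (hQ : Finite Q.V) :
    ∃ (E : Coalgebra G) (_ : Finite E.V), Nonempty (P ⟶ E) ∧ Nonempty (Q ⟶ E) := by
  let C : ULift.{u} Bool → Coalgebra G := fun b => if b.down then P else Q
  exact ⟨sigmaCoalgebra C,
    finite_sigmaCoalgebra C (by rintro ⟨_ | _⟩; exacts [hQ, hP]),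
    ⟨sigmaCoalgebraι C ⟨true⟩⟩, ⟨sigmaCoalgebraι C ⟨false⟩⟩⟩

theorem exists_subcoalgebra {S : Coalgebra G} (D : Set S.V)
    (hD : ∀ d ∈ D, ∃ y : G.obj D, G.map (↾(Subtype.val : D → S.V)) y = S.str d) :
    ∃ (s : (D : Type u) ⟶ G.obj D), s ≫ G.map (↾(Subtype.val : D → S.V)) =
      ↾(Subtype.val : D → S.V) ≫ S.str := by
  obtain ⟨s, hs⟩ := exists_lift_of_range_subset (↾(Subtype.val : D → S.V) ≫ S.str)
    (G.map (↾(Subtype.val : D → S.V))) (fun x => hD x.1 x.2)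
  exact ⟨s, hs⟩

/-- Supplies the closure condition of `exists_subcoalgebra` for states in the image of a
homomorphism: their transitions already live in the image. -/
theorem exists_map_subtype_of_hom {C S : Coalgebra G} (h : C ⟶ S) (D : Set S.V)
    (hD : ∀ x, h.f x ∈ D) (x : C.V) :
    ∃ y : G.obj D, G.map (↾(Subtype.val : D → S.V)) y = S.str (h.f x) := by
  let g : C.V ⟶ (D : Type u) := ↾fun x => ⟨h.f x, hD x⟩
  refine ⟨G.map g (C.str x), ?_⟩
  rw [coalgebraHom_apply, ← G.map_comp_apply]
  rfl

theorem exists_coalgebraLift (hG : ∀ {X Y : Type u} (f : X ⟶ Y), Function.Injective f →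
    Function.Injective (G.map f)) {P D S : Coalgebra G} (h : P ⟶ S) (m : D ⟶ S)
    (hm : Function.Injective m.f) (hr : ∀ x, ∃ y, m.f y = h.f x) : ∃ l : P ⟶ D, l ≫ m = h := by
  obtain ⟨g, hg⟩ := exists_lift_of_range_subset h.f m.f hr
  exact ⟨_, coalgebraLift_comp h m ((mono_iff_injective _).2 (hG _ hm)) g hg⟩

theorem exists_rationalFixpoint_type [PreservesFilteredColimits G]
    (hG : ∀ {X Y : Type u} (f : X ⟶ Y), Function.Injective f → Function.Injective (G.map f)) :
    ∃ R : Coalgebra G, IsRationalFixpoint R ∧ IsIso R.str ∧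
      (∀ X : Coalgebra G, Finite X.V → Nonempty (X ⟶ R)) ∧
      ∀ r : R.V, ∃ (X : Coalgebra G) (_ : Finite X.V) (h : X ⟶ R) (x : X.V), h.f x = r := by
  obtain ⟨N, ⟨hN⟩⟩ := exists_isTerminal_coalgebra G
  let D : Set N.V := {z | ∃ (X : Coalgebra G) (_ : Finite X.V) (h : X ⟶ N) (x : X.V), h.f x = z}
  obtain ⟨s, hs⟩ := exists_subcoalgebra D (by
    rintro _ ⟨X, hX, h, x, rfl⟩
    exact exists_map_subtype_of_hom h D (fun y => ⟨X, hX, h, y, rfl⟩) x)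
  let R : Coalgebra G := ⟨(D : Type u), s⟩
  let i : R ⟶ N := ⟨↾Subtype.val, hs⟩
  have hi : Function.Injective i.f := Subtype.val_injective
  have uniq : ∀ {C : Coalgebra G} (f g : C ⟶ R), f = g := by
    intro C f g
    apply Coalgebra.ext
    have hm : Mono i.f := (mono_iff_injective _).2 hi
    rw [← cancel_mono i.f]
    exact congrArg Coalgebra.Hom.f (hN.hom_ext (f ≫ i) (g ≫ i))
  have fin : ∀ X : Coalgebra G, Finite X.V → Nonempty (X ⟶ R) := fun X hX =>
    have ⟨l, _⟩ := exists_coalgebraLift hG (hN.from X) i hi fun x => ⟨⟨_, X, hX, _, x, rfl⟩, rfl⟩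
    ⟨l⟩
  have surj : ∀ r : R.V, ∃ (X : Coalgebra G) (_ : Finite X.V) (h : X ⟶ R) (x : X.V),
      h.f x = r := by
    rintro ⟨_, X, hX, h, x, rfl⟩
    obtain ⟨l⟩ := fin X hX
    exact ⟨X, hX, l, x, hi (ConcreteCategory.congr_hom (congrArg Coalgebra.Hom.f
      (hN.hom_ext (l ≫ i) h)) x)⟩
  have cover : ∀ (X : Type u) (_ : Finite X) (f : X ⟶ R.V),
      ∃ (P : Coalgebra G) (_ : Finite P.V) (h : P ⟶ R) (g : X ⟶ P.V), g ≫ h.f = f := by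
    -- Finitely many states of `R` are covered at once by the coproduct of the finite coalgebras
    -- covering each of them.
    intro X hX f
    choose P hP h p hp using fun x => surj (f x)
    obtain ⟨l⟩ := fin _ (finite_sigmaCoalgebra P hP)
    refine ⟨_, finite_sigmaCoalgebra P hP, l, ↾fun x => (⟨x, p x⟩ : Σ x, (P x).V), ?_⟩
    refine ConcreteCategory.hom_ext _ _ fun x => Eq.trans ?_ (hp x)
    exact ConcreteCategory.congr_hom (congrArg Coalgebra.Hom.f
      (uniq (sigmaCoalgebraι P x ≫ l) (h x))) (p x)
  have lfp : IsLFPCoalgebra R := by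
    apply isLFPCoalgebra_of_directed
    · intro X hX f
      obtain ⟨P, hP, h, g, hg⟩ := cover X ((finite_iff_isFinitelyPresentable X).1 hX) f
      exact ⟨P, (finite_iff_isFinitelyPresentable _).2 hP, h, g, hg⟩
    · intro P Q hP hQ h k
      rw [finite_iff_isFinitelyPresentable] at hP hQ
      obtain ⟨E, hE, ⟨a⟩, ⟨b⟩⟩ := exists_finite_coalgebra_pair P Q hP hQ
      obtain ⟨e⟩ := fin E hE
      obtain ⟨t, ht⟩ := exists_subcoalgebra (S := R) (Set.range e.f) (by
        rintro _ ⟨x, rfl⟩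
        exact exists_map_subtype_of_hom e (Set.range e.f) (fun y => ⟨y, rfl⟩) x)
      let B : Coalgebra G := ⟨(Set.range e.f : Type u), t⟩
      let m : B ⟶ R := ⟨↾Subtype.val, ht⟩
      have hm : Function.Injective m.f := Subtype.val_injective
      obtain ⟨l, hl⟩ := exists_coalgebraLift hG e m hm
        (fun x => ⟨(⟨e.f x, x, rfl⟩ : Set.range e.f), rfl⟩)
      refine ⟨B, (finite_iff_isFinitelyPresentable _).2 ?_, m, (mono_iff_injective _).2 hm,
        a ≫ l, b ≫ l, uniq _ _, uniq _ _⟩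
      exact Set.finite_range _
  refine ⟨R, ⟨lfp, fun C hC => ?_⟩, ?_, fin, surj⟩
  · obtain ⟨l, -⟩ := exists_coalgebraLift hG (hN.from C) i hi fun c => by
      obtain ⟨P, hP, h, g, hg⟩ := hC.exists_factor
        ((finite_iff_isFinitelyPresentable PUnit).2 inferInstance) (↾fun _ => c)
      rw [finite_iff_isFinitelyPresentable] at hP
      refine ⟨⟨_, P, hP, h ≫ hN.from C, g PUnit.unit, rfl⟩, ?_⟩
      exact congrArg (hN.from C).f (ConcreteCategory.congr_hom hg PUnit.unit)
    exact ⟨l, fun _ => uniq _ _⟩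
  · rw [isIso_iff_bijective]
    constructor
    · have : IsIso N.str := Coalgebra.Terminal.str_isIso hN
      intro x y hxy
      apply hi
      apply (isIso_iff_bijective N.str).1 inferInstance |>.1
      rw [coalgebraHom_apply, coalgebraHom_apply, hxy]
    · intro w
      obtain ⟨n, v, a, rfl⟩ := exists_finite_support G w
      obtain ⟨P, hP, h, g, rfl⟩ := cover _ inferInstance v
      -- The support of the element to be reached lies in the image of the finite coalgebra `P`.
      -- Adjoining one state `none` with that element as its transition keeps the coalgebra finite,
      -- and the image of `none` in `R` is the preimage.
      let E : Coalgebra G := ⟨Option P.V, ↾fun o => G.map (↾some)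
        (o.elim (G.map g a) P.str)⟩
      let j : P ⟶ E := ⟨↾some, by ext x; rfl⟩
      have hE : Finite E.V := inferInstanceAs (Finite (Option P.V))
      obtain ⟨l⟩ := fin E hE
      have h₁ : j.f ≫ l.f = h.f := congrArg Coalgebra.Hom.f (uniq (j ≫ l) h)
      refine ⟨l.f none, ?_⟩
      rw [coalgebraHom_apply, G.map_comp_apply, ← h₁, G.map_comp_apply]
      rfl

theorem IsRationalFixpoint.type_properties [PreservesFilteredColimits G]
    (hG : ∀ {X Y : Type u} (f : X ⟶ Y), Function.Injective f → Function.Injective (G.map f))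
    {R : Coalgebra G} (hR : IsRationalFixpoint R) : IsIso R.str ∧
      (∀ X : Coalgebra G, Finite X.V → Nonempty (X ⟶ R)) ∧
      ∀ r : R.V, ∃ (X : Coalgebra G) (_ : Finite X.V) (h : X ⟶ R) (x : X.V), h.f x = r := by
  obtain ⟨R', hR', h₁, h₂, h₃⟩ := exists_rationalFixpoint_type hG
  obtain ⟨e⟩ := hR'.nonempty_iso hR
  have hinv : e.inv.f ≫ e.hom.f = 𝟙 R.V := congrArg Coalgebra.Hom.f e.inv_hom_id
  have hhom : e.hom.f ≫ e.inv.f = 𝟙 R'.V := congrArg Coalgebra.Hom.f e.hom_inv_id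
  refine ⟨?_, fun X hX => ?_, fun r => ?_⟩
  · have : R.str = e.inv.f ≫ R'.str ≫ G.map e.hom.f := by
      rw [e.hom.h, reassoc_of% hinv]
    have : IsIso e.inv.f := ⟨_, hinv, hhom⟩
    have : IsIso e.hom.f := ⟨_, hhom, hinv⟩
    rw [‹R.str = _›]
    infer_instance
  · obtain ⟨f⟩ := h₂ X hX
    exact ⟨f ≫ e.hom⟩
  · obtain ⟨X, hX, h, x, hx⟩ := h₃ (e.inv.f r)
    refine ⟨X, hX, h ≫ e.hom, x, ?_⟩
    exact (congrArg e.hom.f hx).trans (ConcreteCategory.congr_hom hinv r)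

end CoalgebrasInTypes

/-! ### Finitely generated and finitely presentable algebras -/

section Algebras

variable {T : CategoryTheory.Monad (Type u)}

theorem algebraHom_apply {A B : T.Algebra} (f : A ⟶ B) (t : T.obj A.A) :
    B.a (T.map f.f t) = f.f (A.a t) :=
  ConcreteCategory.congr_hom f.h t

theorem algebra_mono_of_injective {A B : T.Algebra} (f : A ⟶ B) (hf : Function.Injective f.f) :
    Mono f :=
  have := (mono_iff_injective f.f).2 hf
  CategoryTheory.Monad.algebra_mono_of_mono T f

theorem map_extend {X : Type u} {A : T.Algebra} (f : X ⟶ A.A) :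
    T.map (T.map f ≫ A.a) ≫ A.a = T.μ.app X ≫ T.map f ≫ A.a := by
  have h : T.μ.app X ≫ T.map f = T.map (T.map f) ≫ T.μ.app A.A := (T.μ.naturality f).symm
  rw [Functor.map_comp, Category.assoc, ← A.assoc, ← Category.assoc, ← h, Category.assoc]

/-- The homomorphism from a free algebra that extends a map. -/
def freeExtend {X : Type u} {A : T.Algebra} (f : X ⟶ A.A) : T.free.obj X ⟶ A where
  f := T.map f ≫ A.a
  h := map_extend f

theorem unit_freeExtend {X : Type u} {A : T.Algebra} (f : X ⟶ A.A) :
    T.η.app X ≫ (freeExtend f).f = f := by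
  have h : T.η.app X ≫ T.map f = f ≫ T.η.app A.A := (T.η.naturality f).symm
  change T.η.app X ≫ T.map f ≫ A.a = f
  rw [← Category.assoc, h, Category.assoc, A.unit, Category.comp_id]

theorem unit_freeExtend_apply {X : Type u} {A : T.Algebra} (f : X ⟶ A.A) (x : X) :
    (freeExtend f).f (T.η.app X x) = f x :=
  ConcreteCategory.congr_hom (unit_freeExtend f) x

theorem free_hom_ext {X : Type u} {A : T.Algebra} {f g : T.free.obj X ⟶ A}
    (h : T.η.app X ≫ f.f = T.η.app X ≫ g.f) : f = g := by
  have key : ∀ k : T.obj X ⟶ A.A, T.map k ≫ A.a = T.μ.app X ≫ k →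
      k = T.map (T.η.app X ≫ k) ≫ A.a := by
    intro k hk
    rw [Functor.map_comp, Category.assoc, hk, ← Category.assoc, T.right_unit, Category.id_comp]
  apply Monad.Algebra.Hom.ext
  exact (key f.f f.h).trans ((congrArg (fun k => T.map k ≫ A.a) h).trans (key g.f g.h).symm)

theorem exists_algebraHom_lift {X Y Z : T.Algebra} (f : X ⟶ Z) (j : Y ⟶ Z)
    (hj : Function.Injective j.f) (h : ∀ x, ∃ y, j.f y = f.f x) : ∃ g : X ⟶ Y, g ≫ j = f := by
  obtain ⟨g, hg⟩ := exists_lift_of_range_subset f.f j.f h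
  have := (mono_iff_injective j.f).2 hj
  refine ⟨⟨g, ?_⟩, Monad.Algebra.Hom.ext hg⟩
  rw [← cancel_mono j.f, Category.assoc, ← j.h, ← Category.assoc, ← T.map_comp, hg, f.h,
    Category.assoc, hg]

theorem exists_algebraHom_desc {A Q B : T.Algebra} (e : A ⟶ Q) (f : A ⟶ B)
    (he : Function.Surjective e.f) (h : ∀ x y, e.f x = e.f y → f.f x = f.f y) :
    ∃ g : Q ⟶ B, e ≫ g = f := by
  let g : Q.A ⟶ B.A := ↾fun z => f.f (Function.surjInv he z)
  have hg : e.f ≫ g = f.f := by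
    ext x
    exact h _ _ (Function.surjInv_eq he (e.f x))
  have : Epi (T.map e.f) := (epi_iff_surjective _).2
    (map_surjective_of_surjective T.toFunctor e.f he)
  refine ⟨⟨g, ?_⟩, Monad.Algebra.Hom.ext hg⟩
  rw [← cancel_epi (T.map e.f), ← Category.assoc, ← T.map_comp, hg, f.h, ← Category.assoc, e.h,
    Category.assoc, hg]

/-- The subalgebra on a subset that is closed under the operations. -/
def subalgebra (A : T.Algebra) (D : Set A.A)
    (hD : ∀ t : T.obj D, A.a (T.map (↾(Subtype.val : D → A.A)) t) ∈ D) : T.Algebra where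
  A := (D : Type u)
  a := ↾fun t => ⟨A.a (T.map (↾(Subtype.val : D → A.A)) t), hD t⟩
  unit := by
    refine ConcreteCategory.hom_ext _ _ fun x => Subtype.ext ?_
    exact (congrArg A.a (ConcreteCategory.congr_hom
      (T.η.naturality (↾(Subtype.val : D → A.A))) x).symm).trans
      (ConcreteCategory.congr_hom A.unit x.1)
  assoc := by
    refine ConcreteCategory.hom_ext _ _ fun x => Subtype.ext ?_
    refine (congrArg A.a (ConcreteCategory.congr_hom
      (T.μ.naturality (↾(Subtype.val : D → A.A))) x).symm).trans ?_
    refine (ConcreteCategory.congr_hom A.assoc _).trans (congrArg A.a ?_)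
    let i : (D : Type u) ⟶ A.A := ↾Subtype.val
    let a : T.obj D ⟶ (D : Type u) := ↾fun t => ⟨A.a (T.map i t), hD t⟩
    exact (T.toFunctor.map_comp_apply (T.map i) A.a x).symm.trans
      (T.toFunctor.map_comp_apply a i x)

/-- The inclusion of a subalgebra. -/
def subalgebraι (A : T.Algebra) (D : Set A.A)
    (hD : ∀ t : T.obj D, A.a (T.map (↾(Subtype.val : D → A.A)) t) ∈ D) :
    subalgebra A D hD ⟶ A where
  f := ↾Subtype.val
  h := rfl

/-- `T` preserves surjections, so a term over the image lifts to a term over `A`, which is evaluated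
there. -/
theorem range_closed {A B : T.Algebra} (f : A ⟶ B) (t : T.obj (Set.range f.f)) :
    B.a (T.map (↾(Subtype.val : Set.range f.f → B.A)) t) ∈ Set.range f.f := by
  let e : A.A ⟶ (Set.range f.f : Type u) := ↾fun x => ⟨f.f x, x, rfl⟩
  obtain ⟨s, rfl⟩ := map_surjective_of_surjective T.toFunctor e
    (by rintro ⟨_, x, rfl⟩; exact ⟨x, rfl⟩) t
  refine ⟨A.a s, ?_⟩
  rw [← algebraHom_apply, ← T.toFunctor.map_comp_apply]
  rfl

theorem IsFGAlgebra.of_surjective {A B : T.Algebra} (hA : IsFGAlgebra A) (f : A ⟶ B)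
    (hf : Function.Surjective f.f) : IsFGAlgebra B := by
  obtain ⟨X, hX, e, he⟩ := hA
  exact ⟨X, hX, e ≫ f, hf.comp he⟩

theorem isFGAlgebra_free (X : Type u) [Finite X] : IsFGAlgebra (T.free.obj X) :=
  ⟨X, inferInstance, 𝟙 _, fun x => ⟨x, rfl⟩⟩

/-- The set of elements generated by a subset of an algebra. -/
def generatedSet (A : T.Algebra) (s : Set A.A) : Set A.A :=
  Set.range (freeExtend (↾(Subtype.val : s → A.A))).f

theorem subset_generatedSet (A : T.Algebra) (s : Set A.A) : s ⊆ generatedSet A s :=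
  fun x hx => ⟨T.η.app _ ⟨x, hx⟩, unit_freeExtend_apply _ _⟩

theorem generatedSet_mono (A : T.Algebra) {s t : Set A.A} (h : s ⊆ t) :
    generatedSet A s ⊆ generatedSet A t := by
  rintro _ ⟨x, rfl⟩
  refine ⟨T.map (↾(Set.inclusion h)) x, ?_⟩
  exact congrArg A.a (T.toFunctor.map_comp_apply (↾(Set.inclusion h)) (↾Subtype.val) x).symm

/-! ### Finitely generated versus finitely presentable algebras -/

section Finitary

variable [PreservesFilteredColimits T.toFunctor]

instance : PreservesFilteredColimits T.forget where
  preserves_filtered_colimits _ _ _ := inferInstance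

theorem isFinitelyPresentable_free (X : Type u) [Finite X] :
    IsFinitelyPresentable.{u} (T.free.obj X) := by
  have : Fact Cardinal.aleph0.{u}.IsRegular := Cardinal.fact_isRegular_aleph0
  have : IsCardinalPresentable X Cardinal.aleph0.{u} :=
    (finite_iff_isFinitelyPresentable X).2 inferInstance
  have : T.forget.IsFinitelyAccessible :=
    Functor.isFinitelyAccessible_iff_preservesFilteredColimits.2 inferInstance
  -- A left adjoint of a finitary functor preserves finitely presentable objects.
  exact T.adj.isCardinalPresentable_leftAdjoint_obj Cardinal.aleph0.{u} X

/-- The diagram of the finitely generated subalgebras of an algebra. -/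
def fgSubalgebras (A : T.Algebra) : HasCardinalLT.Set A.A Cardinal.aleph0.{u} ⥤ T.Algebra where
  obj s := subalgebra A (generatedSet A s.1) (range_closed _)
  map {s t} h :=
    { f := ↾Set.inclusion (generatedSet_mono A (leOfHom h))
      h := by
        refine ConcreteCategory.hom_ext _ _ fun x => Subtype.ext ?_
        exact congrArg A.a (T.toFunctor.map_comp_apply
          (↾(Set.inclusion (generatedSet_mono A (leOfHom h)))) (↾Subtype.val) x).symm }

/-- An algebra as a cocone on its finitely generated subalgebras. -/
def fgSubalgebrasCocone (A : T.Algebra) : Cocone (fgSubalgebras A) where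
  pt := A
  ι := { app s := subalgebraι A (generatedSet A s.1) (range_closed _) }

/-- An algebra is the filtered colimit of its finitely generated subalgebras. -/
noncomputable def isColimitFgSubalgebrasCocone (A : T.Algebra) :
    IsColimit (fgSubalgebrasCocone A) := by
  have := HasCardinalLT.Set.isFiltered_of_aleph0_le A.A Cardinal.aleph0.{u} le_rfl
  refine isColimitOfReflects T.forget (Types.FilteredColimit.isColimitOf' _ _ (fun x => ?_) ?_)
  · exact ⟨⟨({x} : Set A.A), (hasCardinalLT_aleph0_iff _).2 (Set.finite_singleton (α := A.A) x)⟩,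
      ⟨x, subset_generatedSet A {x} rfl⟩, rfl⟩
  · rintro s ⟨x, hx⟩ ⟨y, hy⟩ h
    obtain rfl : x = y := h
    exact ⟨s, 𝟙 _, rfl⟩

/-- The identity of `A` factors through a stage of the filtered colimit of finitely generated
subalgebras, so that stage is all of `A`. -/
theorem IsFGAlgebra.of_isFinitelyPresentable (A : T.Algebra)
    [IsFinitelyPresentable.{u} A] : IsFGAlgebra A := by
  have := HasCardinalLT.Set.isFiltered_of_aleph0_le A.A Cardinal.aleph0.{u} le_rfl
  obtain ⟨⟨s, hs⟩, p, hp⟩ :=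
    IsFinitelyPresentable.exists_hom_of_isColimit (isColimitFgSubalgebrasCocone A) (𝟙 A)
  rw [hasCardinalLT_aleph0_iff] at hs
  refine ⟨s, hs, freeExtend (↾(Subtype.val : s → A.A)), fun x => ?_⟩
  have hp' : p.f ≫ (subalgebraι A (generatedSet A s) (range_closed _)).f = 𝟙 A.A :=
    congrArg Monad.Algebra.Hom.f hp
  have h : (p.f x).1 = x := (ConcreteCategory.congr_hom hp' x :)
  obtain ⟨t, ht⟩ := (p.f x).2
  exact ⟨t, ht.trans h⟩

/-- A cover `TX ⟶ A` is the coequaliser of its kernel pair. That kernel pair is itself covered by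
some `TY` with `Y` finite, so `A` is a coequaliser of two maps between finitely presentable free
algebras. -/
theorem IsFGAlgebra.isFinitelyPresentable (hker : FGClosedUnderKernelPairs T) {A : T.Algebra}
    (hA : IsFGAlgebra A) : IsFinitelyPresentable.{u} A := by
  obtain ⟨X, hX, e, he⟩ := hA
  have : HasPullback e e := hasLimit_of_created (cospan e e) T.forget
  have hK : IsKernelPair e (pullback.fst e e) (pullback.snd e e) := IsPullback.of_hasPullback e e
  obtain ⟨Y, hY, e', he'⟩ := hker _ _ _ hK (isFGAlgebra_free X)
  have w : (e' ≫ pullback.fst e e) ≫ e = (e' ≫ pullback.snd e e) ≫ e := by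
    rw [Category.assoc, hK.w, Category.assoc]
  have kp : ∀ x y, e.f x = e.f y → ∃ z, (e' ≫ pullback.fst e e).f z = x ∧
      (e' ≫ pullback.snd e e).f z = y := by
    intro x y hxy
    -- Elements are represented by homomorphisms from the free algebra on one generator, so that the
    -- universal property of the pullback yields an element above `(x, y)`.
    let p (x : (T.free.obj X).A) : T.free.obj PUnit ⟶ T.free.obj X := freeExtend (↾fun _ => x)
    have hp : ∀ x, (p x).f (T.η.app _ PUnit.unit) = x := fun x => unit_freeExtend_apply _ _
    have hw : p x ≫ e = p y ≫ e := by
      apply free_hom_ext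
      ext ⟨⟩
      exact (congrArg e.f (hp x)).trans (hxy.trans (congrArg e.f (hp y)).symm)
    obtain ⟨z, hz⟩ := he' ((pullback.lift (p x) (p y) hw).f (T.η.app _ PUnit.unit))
    refine ⟨z, ?_, ?_⟩
    · refine (congrArg (pullback.fst e e).f hz).trans (Eq.trans ?_ (hp x))
      exact ConcreteCategory.congr_hom (congrArg Monad.Algebra.Hom.f
        (pullback.lift_fst (p x) (p y) hw)) _
    · refine (congrArg (pullback.snd e e).f hz).trans (Eq.trans ?_ (hp y))
      exact ConcreteCategory.congr_hom (congrArg Monad.Algebra.Hom.f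
        (pullback.lift_snd (p x) (p y) hw)) _
  have hepi : Epi e := by
    have := (epi_iff_surjective e.f).2 he
    exact CategoryTheory.Monad.algebra_epi_of_epi T e
  have desc : ∀ s : Cofork (e' ≫ pullback.fst e e) (e' ≫ pullback.snd e e),
      ∃ g : A ⟶ s.pt, e ≫ g = s.π := by
    intro s
    refine exists_algebraHom_desc e s.π he fun x y hxy => ?_
    obtain ⟨z, rfl, rfl⟩ := kp x y hxy
    exact ConcreteCategory.congr_hom (congrArg Monad.Algebra.Hom.f s.condition) z
  choose d hd using desc
  have hc : IsColimit (Cofork.ofπ e w) := Cofork.IsColimit.mk _ d hd fun s m hm => by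
    rw [← cancel_epi e, hd]
    exact hm
  have : Fact Cardinal.aleph0.{u}.IsRegular := Cardinal.fact_isRegular_aleph0
  have : ∀ k, IsCardinalPresentable
      ((parallelPair (e' ≫ pullback.fst e e) (e' ≫ pullback.snd e e)).obj k)
      Cardinal.aleph0.{u} := by
    rintro (_ | _)
    · exact isFinitelyPresentable_free Y
    · exact isFinitelyPresentable_free X
  exact isCardinalPresentable_of_isColimit _ hc Cardinal.aleph0.{u}
    (hasCardinalLT_of_finite _ _ le_rfl)

end Finitary

end Algebras

/-! ### The final coalgebra of a lifted functor -/

namespace Lifting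

variable {T : CategoryTheory.Monad (Type u)} {F : Type u ⥤ Type u} (L : Lifting T F)

theorem map_freeStr {X Y : Type u} (f : X ⟶ Y) :
    T.map (F.map (T.map f)) ≫ L.freeStr Y = L.freeStr X ≫ F.map (T.map f) :=
  L.map_hom (T.free.map f)

theorem freeStr_map_a (A : T.Algebra) :
    L.freeStr A.A ≫ F.map A.a = T.map (F.map A.a) ≫ L.str A :=
  let γ : T.free.obj A.A ⟶ A := { f := A.a, h := A.assoc.symm }
  (L.map_hom γ).symm

theorem map_ext_of_comm {X Y : Type u} {c : X ⟶ F.obj (T.obj X)} {d : Y ⟶ F.obj (T.obj Y)}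
    (f : X ⟶ Y) (h : c ≫ F.map (T.map f) = f ≫ d) :
    L.ext c ≫ F.map (T.map f) = T.map f ≫ L.ext d := by
  rw [ext, ext, Category.assoc, ← L.map_freeStr, ← Category.assoc, ← T.map_comp, h, T.map_comp,
    Category.assoc]

/-- When `x` is a homomorphism, the right side is `A.a ≫ x`, and the equation says that `A.a` is a
coalgebra homomorphism. Stated for a mere map, it also serves to prove that `Z.str` is a
homomorphism. -/
theorem ext_unit_comp_map_a (A : T.Algebra) (x : A.A ⟶ F.obj A.A) :
    L.ext (x ≫ F.map (T.η.app A.A)) ≫ F.map A.a = T.map x ≫ L.str A := by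
  rw [ext, Category.assoc, freeStr_map_a, ← Category.assoc, ← T.map_comp, Category.assoc,
    ← F.map_comp, A.unit, F.map_id, Category.comp_id]

/-- The generalised powerset construction on homomorphisms. -/
def detMap {C D : Coalgebra (T.toFunctor ⋙ F)} (f : C ⟶ D) : L.det C ⟶ L.det D where
  f := T.free.map f.f
  h := Monad.Algebra.Hom.ext (L.map_ext_of_comm (X := C.V) (Y := D.V) f.f f.h)

/-- The homomorphism of `F`-coalgebras underlying a homomorphism of `F̄`-coalgebras. -/
def underlyingMap {C D : Coalgebra L.functor} (f : C ⟶ D) : L.underlying C ⟶ L.underlying D where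
  f := f.f.f
  h := congrArg Monad.Algebra.Hom.f f.h

/-- An `F`-coalgebra as an `FT`-coalgebra, via the unit of the monad. -/
def embed (T : CategoryTheory.Monad (Type u)) {F : Type u ⥤ Type u} (X : Coalgebra F) :
    Coalgebra (T.toFunctor ⋙ F) where
  V := X.V
  str := X.str ≫ F.map (T.η.app X.V)

/-- The action of `embed` on homomorphisms. -/
def embedMap (T : CategoryTheory.Monad (Type u)) {F : Type u ⥤ Type u} {X Y : Coalgebra F}
    (f : X ⟶ Y) : embed T X ⟶ embed T Y where
  f := f.f
  h := by
    have h : f.f ≫ T.η.app Y.V = T.η.app X.V ≫ T.map f.f := T.η.naturality f.f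
    change (X.str ≫ F.map (T.η.app X.V)) ≫ F.map (T.map f.f) =
      f.f ≫ Y.str ≫ F.map (T.η.app Y.V)
    rw [Category.assoc, ← F.map_comp, ← h, F.map_comp, ← Category.assoc, f.h, Category.assoc]

/-- The free `F̄`-coalgebra structure on the free algebra on the carrier of an `F`-coalgebra, as an
`F`-coalgebra. -/
abbrev extendCoalgebra (X : Coalgebra F) : Coalgebra F := L.underlying (L.det (embed T X))

/-- The unit as a coalgebra homomorphism. -/
def unitHom (X : Coalgebra F) : X ⟶ L.extendCoalgebra X where
  f := T.η.app X.V
  h := (L.unit_ext (X := X.V) (X.str ≫ F.map (T.η.app X.V))).symm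

/-- The algebra structure of an `F̄`-coalgebra as a coalgebra homomorphism. -/
def structureHom (D : Coalgebra L.functor) :
    L.extendCoalgebra (L.underlying D) ⟶ L.underlying D where
  f := D.V.a
  h := (L.ext_unit_comp_map_a D.V D.str.f).trans D.str.h

section FinalCoalgebra

variable {Z : Coalgebra F} (hZ : IsTerminal Z)

/-- The canonical algebra structure on the carrier of the final coalgebra. -/
def finalAlgebra : T.Algebra where
  A := Z.V
  a := (hZ.from (L.extendCoalgebra Z)).f
  -- Both algebra laws equate coalgebra homomorphisms into `Z`: from `Z` itself for the unit, and
  -- from the twofold extension on `TTZ` for associativity.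
  unit := congrArg Coalgebra.Hom.f
    (hZ.hom_ext (L.unitHom Z ≫ hZ.from (L.extendCoalgebra Z)) (𝟙 Z))
  assoc := congrArg Coalgebra.Hom.f (hZ.hom_ext
    (L.structureHom (L.det (embed T Z)) ≫ hZ.from (L.extendCoalgebra Z))
    (L.underlyingMap (L.detMap (embedMap T (hZ.from (L.extendCoalgebra Z)))) ≫
      hZ.from (L.extendCoalgebra Z)))

/-- The final coalgebra of `F` as a coalgebra of the lifting. -/
def finalCoalgebra : Coalgebra L.functor where
  V := L.finalAlgebra hZ
  str :=
    { f := Z.str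
      h := (L.ext_unit_comp_map_a (L.finalAlgebra hZ) Z.str).symm.trans
        (hZ.from (L.extendCoalgebra Z)).h }

/-- The behaviour of a coalgebra of the lifting. -/
def behaviour (D : Coalgebra L.functor) : D ⟶ L.finalCoalgebra hZ where
  f :=
    { f := (hZ.from (L.underlying D)).f
      -- The final map respects the operations because both composites `TD ⟶ Z` are coalgebra
      -- homomorphisms.
      h := congrArg Coalgebra.Hom.f (hZ.hom_ext
        (L.underlyingMap (L.detMap (embedMap T (hZ.from (L.underlying D)))) ≫
          hZ.from (L.extendCoalgebra Z))
        (L.structureHom D ≫ hZ.from (L.underlying D))) }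
  h := Monad.Algebra.Hom.ext (hZ.from (L.underlying D)).h

theorem hom_finalCoalgebra_ext {D : Coalgebra L.functor} (f g : D ⟶ L.finalCoalgebra hZ) :
    f = g :=
  Coalgebra.ext (Monad.Algebra.Hom.ext (congrArg Coalgebra.Hom.f
    (hZ.hom_ext (Y := L.underlying D) (L.underlyingMap f) (L.underlyingMap g))))

theorem behaviour_naturality {C D : Coalgebra L.functor} (f : C ⟶ D) :
    f ≫ L.behaviour hZ D = L.behaviour hZ C :=
  L.hom_finalCoalgebra_ext hZ _ _

theorem behaviour_apply {C D : Coalgebra L.functor} (f : C ⟶ D) (x : C.V.A) :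
    (L.behaviour hZ D).f.f (f.f.f x) = (L.behaviour hZ C).f.f x := by
  rw [← L.behaviour_naturality hZ f]
  rfl

end FinalCoalgebra

/-! ### Subcoalgebras, lifts and covers for a lifted functor -/

theorem exists_subcoalgebra_of_injective
    (hF : ∀ {X Y : Type u} (f : X ⟶ Y), Function.Injective f → Function.Injective (F.map f))
    (S : Coalgebra L.functor) (B : T.Algebra) (j : B ⟶ S.V)
    (hj : Function.Injective j.f) (h : ∀ b, ∃ y, F.map j.f y = S.str.f (j.f b)) :
    ∃ s : B ⟶ L.functor.obj B, s ≫ L.functor.map j = j ≫ S.str :=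
  exists_algebraHom_lift (j ≫ S.str) (L.functor.map j) (hF _ hj) h

theorem exists_coalgebraLift
    (hF : ∀ {X Y : Type u} (f : X ⟶ Y), Function.Injective f → Function.Injective (F.map f))
    {P D S : Coalgebra L.functor} (h : P ⟶ S) (m : D ⟶ S)
    (hm : Function.Injective m.f.f) (hr : ∀ x, ∃ y, m.f.f y = h.f.f x) :
    ∃ l : P ⟶ D, l ≫ m = h := by
  obtain ⟨g, hg⟩ := exists_algebraHom_lift h.f m.f hm hr
  exact ⟨_, coalgebraLift_comp h m (algebra_mono_of_injective _ (hF _ hm)) g hg⟩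

/-- Homomorphisms from coalgebras with finitely generated carrier have images. -/
theorem exists_image
    (hF : ∀ {X Y : Type u} (f : X ⟶ Y), Function.Injective f → Function.Injective (F.map f))
    {E S : Coalgebra L.functor} (l : E ⟶ S) :
    ∃ (B : Coalgebra L.functor) (m : B ⟶ S), Function.Injective m.f.f ∧
      Set.range m.f.f = Set.range l.f.f ∧ (IsFGAlgebra E.V → IsFGAlgebra B.V) := by
  let A := subalgebra S.V (Set.range l.f.f) (range_closed l.f)
  let j : A ⟶ S.V := subalgebraι S.V (Set.range l.f.f) (range_closed l.f)
  have hj : Function.Injective j.f := Subtype.val_injective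
  obtain ⟨s, hs⟩ := L.exists_subcoalgebra_of_injective hF S A j hj (by
    rintro ⟨_, x, rfl⟩
    exact exists_map_subtype_of_hom (L.underlyingMap l) (Set.range l.f.f) (fun y => ⟨y, rfl⟩) x)
  refine ⟨⟨A, s⟩, ⟨j, hs⟩, hj, Subtype.range_val, fun hE => ?_⟩
  obtain ⟨g, hg⟩ := exists_algebraHom_lift l.f j hj
    (fun x => ⟨(⟨l.f.f x, x, rfl⟩ : Set.range l.f.f), rfl⟩)
  refine hE.of_surjective g ?_
  rintro ⟨_, x, rfl⟩
  exact ⟨x, hj (ConcreteCategory.congr_hom (congrArg Monad.Algebra.Hom.f hg) x)⟩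

/-- A coalgebra with finitely generated carrier is a quotient of the determinisation of a finite
`FT`-coalgebra. -/
theorem exists_det_cover (P : Coalgebra L.functor) (hP : IsFGAlgebra P.V) :
    ∃ (X : Coalgebra (T.toFunctor ⋙ F)) (_ : Finite X.V) (e : L.det X ⟶ P),
      Function.Surjective e.f.f := by
  obtain ⟨X, hX, e, he⟩ := hP
  -- `F e` is surjective, so the transitions of the generators lift to `FTX`; it is enough to check
  -- that `e` is a coalgebra homomorphism on generators.
  obtain ⟨c, hc⟩ := exists_lift_of_range_subset (T.η.app X ≫ e.f ≫ P.str.f) (F.map e.f)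
    (fun x => map_surjective_of_surjective F e.f he _)
  refine ⟨⟨X, c⟩, hX, ⟨e, ?_⟩, he⟩
  refine free_hom_ext (T := T) (X := X) (A := L.functor.obj P.V) ?_
  refine Eq.trans ?_ hc
  exact congrArg (· ≫ F.map e.f) (L.unit_ext c)

end Lifting

/-! ### The rational fixpoint of a lifted functor -/

namespace Lifting

variable {T : CategoryTheory.Monad (Type u)} {F : Type u ⥤ Type u} (L : Lifting T F)

/-- The behaviours of the elements of the determinisations of finite `FT`-coalgebras. -/
def rationalSet {Z : Coalgebra F} (hZ : IsTerminal Z) : Set Z.V :=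
  {z | ∃ (X : Coalgebra (T.toFunctor ⋙ F)) (_ : Finite X.V) (t : T.obj X.V),
    (L.behaviour hZ (L.det X)).f.f t = z}

/-- A finite family of elements of `rationalSet` is realised in one finite coalgebra. -/
theorem exists_finite_of_mem_rationalSet {Z : Coalgebra F} (hZ : IsTerminal Z) {ι : Type u}
    [Finite ι] (v : ι → Z.V) (hv : ∀ i, v i ∈ L.rationalSet hZ) :
    ∃ (E : Coalgebra (T.toFunctor ⋙ F)) (_ : Finite E.V) (g : ι ⟶ T.obj E.V),
      ∀ i, (L.behaviour hZ (L.det E)).f.f (g i) = v i := by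
  choose X hX t ht using hv
  refine ⟨sigmaCoalgebra X, finite_sigmaCoalgebra X hX,
    ↾fun i => T.map (sigmaCoalgebraι X i).f (t i), fun i => ?_⟩
  exact (L.behaviour_apply hZ (L.detMap (sigmaCoalgebraι X i)) (t i)).trans (ht i)

/-- A term involves only finitely many behaviours, all realised in one `TE` with `E` finite. The
term is evaluated in `TE` by `μ`, and the behaviour map is an algebra homomorphism. -/
theorem rationalSet_closed [PreservesFilteredColimits T.toFunctor] {Z : Coalgebra F}
    (hZ : IsTerminal Z) (t : T.obj (L.rationalSet hZ)) :
    (L.finalAlgebra hZ).a (T.map (↾(Subtype.val : L.rationalSet hZ → Z.V)) t) ∈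
      L.rationalSet hZ := by
  obtain ⟨n, v, a, rfl⟩ := exists_finite_support T.toFunctor t
  obtain ⟨E, hE, g, hg⟩ := L.exists_finite_of_mem_rationalSet hZ (fun i => (v i).1)
    (fun i => (v i).2)
  refine ⟨E, hE, T.μ.app E.V (T.map g a), ?_⟩
  have h : g ≫ (show T.obj E.V ⟶ Z.V from (L.behaviour hZ (L.det E)).f.f) =
      v ≫ ↾(Subtype.val : L.rationalSet hZ → Z.V) :=
    ConcreteCategory.hom_ext _ _ hg
  refine (algebraHom_apply (L.behaviour hZ (L.det E)).f (T.map g a)).symm.trans ?_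
  refine congrArg (L.finalAlgebra hZ).a ?_
  refine (T.toFunctor.map_comp_apply g _ a).symm.trans (Eq.trans ?_
    (T.toFunctor.map_comp_apply v _ a))
  exact ConcreteCategory.congr_hom (congrArg T.map h) a

theorem exists_rationalFixpoint [PreservesFilteredColimits T.toFunctor]
    (hF : ∀ {X Y : Type u} (f : X ⟶ Y), Function.Injective f → Function.Injective (F.map f))
    (hker : FGClosedUnderKernelPairs T) {Z : Coalgebra F} (hZ : IsTerminal Z) :
    ∃ (S : Coalgebra L.functor) (i : S ⟶ L.finalCoalgebra hZ), IsRationalFixpoint S ∧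
      Function.Injective i.f.f ∧ Set.range i.f.f = L.rationalSet hZ := by
  let A := subalgebra (L.finalAlgebra hZ) (L.rationalSet hZ) (L.rationalSet_closed hZ)
  let j : A ⟶ L.finalAlgebra hZ :=
    subalgebraι (L.finalAlgebra hZ) (L.rationalSet hZ) (L.rationalSet_closed hZ)
  have hj : Function.Injective j.f := Subtype.val_injective
  obtain ⟨s, hs⟩ := L.exists_subcoalgebra_of_injective hF (L.finalCoalgebra hZ) A j hj (by
    rintro ⟨_, X, hX, x, rfl⟩
    exact exists_map_subtype_of_hom (L.underlyingMap (L.behaviour hZ (L.det X)))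
      (L.rationalSet hZ) (fun y => ⟨X, hX, y, rfl⟩) x)
  let S : Coalgebra L.functor := ⟨A, s⟩
  let i : S ⟶ L.finalCoalgebra hZ := ⟨j, hs⟩
  have hi : Function.Injective i.f.f := hj
  have hr : ∀ z, z ∈ L.rationalSet hZ → ∃ y, i.f.f y = z := fun z hz => ⟨⟨z, hz⟩, rfl⟩
  have uniq : ∀ {C : Coalgebra L.functor} (f g : C ⟶ S), f = g := by
    intro C f g
    apply Coalgebra.ext
    have : Mono i.f := algebra_mono_of_injective _ hi
    rw [← cancel_mono i.f]
    exact congrArg Coalgebra.Hom.f (L.hom_finalCoalgebra_ext hZ (f ≫ i) (g ≫ i))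
  have lift : ∀ C : Coalgebra L.functor,
      (∀ c, (L.behaviour hZ C).f.f c ∈ L.rationalSet hZ) → Nonempty (C ⟶ S) := fun C hC =>
    have ⟨l, _⟩ := L.exists_coalgebraLift hF (L.behaviour hZ C) i hi fun c => hr _ (hC c)
    ⟨l⟩
  have fin : ∀ X : Coalgebra (T.toFunctor ⋙ F), Finite X.V → Nonempty (L.det X ⟶ S) :=
    fun X hX => lift _ fun t => ⟨X, hX, t, rfl⟩
  have lfp : IsLFPCoalgebra S := by
    apply isLFPCoalgebra_of_directed
    · intro X hX f
      -- The images of the finitely many generators of `X` are realised in one `TE`. The image of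
      -- `TE` in `S` then contains the image of `f`, and its carrier is finitely generated, hence
      -- finitely presentable.
      obtain ⟨X₀, hX₀, e, he⟩ := IsFGAlgebra.of_isFinitelyPresentable X
      obtain ⟨E, hE, g, hg⟩ := L.exists_finite_of_mem_rationalSet hZ (ι := X₀)
        (fun x => (f.f (e.f (T.η.app X₀ x))).1) (fun x => (f.f (e.f (T.η.app X₀ x))).2)
      obtain ⟨l⟩ := fin E hE
      obtain ⟨B, m, hm, hrange, hfg⟩ := L.exists_image hF l
      have hl : ∀ t, i.f.f (l.f.f t) = (L.behaviour hZ (L.det E)).f.f t := fun t =>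
        ConcreteCategory.congr_hom (congrArg Monad.Algebra.Hom.f
          (congrArg Coalgebra.Hom.f (L.hom_finalCoalgebra_ext hZ (l ≫ i) (L.behaviour hZ _)))) t
      have hfac : freeExtend (A := T.free.obj E.V) g ≫ l.f = e ≫ f := by
        apply free_hom_ext
        refine ConcreteCategory.hom_ext _ _ fun x => hi ?_
        refine (congrArg (fun y => i.f.f (l.f.f y))
          (unit_freeExtend_apply (A := T.free.obj E.V) g x)).trans ?_
        exact (hl _).trans (hg x)
      obtain ⟨k, hk⟩ := exists_algebraHom_lift f m.f hm fun x => by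
        obtain ⟨t, rfl⟩ := he x
        rw [← Set.mem_range, hrange]
        exact ⟨_, ConcreteCategory.congr_hom (congrArg Monad.Algebra.Hom.f hfac) t⟩
      exact ⟨B, (hfg (isFGAlgebra_free (T := T) E.V)).isFinitelyPresentable hker, m, k, hk⟩
    · intro P Q hP hQ h k
      -- Both coalgebras are covered by determinisations of finite coalgebras `X` and `Y`, which map
      -- to a common finite `E`. The image of `TE` in `S` therefore contains the images of `h` and
      -- `k`.
      obtain ⟨X, hX, e, he⟩ := L.exists_det_cover P (IsFGAlgebra.of_isFinitelyPresentable P.V)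
      obtain ⟨Y, hY, e', he'⟩ := L.exists_det_cover Q (IsFGAlgebra.of_isFinitelyPresentable Q.V)
      obtain ⟨E, hE, ⟨a⟩, ⟨b⟩⟩ := exists_finite_coalgebra_pair X Y hX hY
      obtain ⟨l⟩ := fin E hE
      obtain ⟨B, m, hm, hrange, hfg⟩ := L.exists_image hF l
      have key : ∀ {X : Coalgebra (T.toFunctor ⋙ F)} {P : Coalgebra L.functor} (e : L.det X ⟶ P)
          (_ : Function.Surjective e.f.f) (a : X ⟶ E) (h : P ⟶ S), ∃ h' : P ⟶ B, h' ≫ m = h := by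
        intro X P e he a h
        refine L.exists_coalgebraLift hF h m hm fun p => ?_
        obtain ⟨t, rfl⟩ := he p
        rw [← Set.mem_range, hrange]
        exact ⟨_, ConcreteCategory.congr_hom (congrArg Monad.Algebra.Hom.f
          (congrArg Coalgebra.Hom.f (uniq (L.detMap a ≫ l) (e ≫ h)))) t⟩
      obtain ⟨h', hh⟩ := key e he a h
      obtain ⟨k', hk⟩ := key e' he' b k
      exact ⟨B, (hfg (isFGAlgebra_free (T := T) E.V)).isFinitelyPresentable hker, m,
        algebra_mono_of_injective _ hm, h', k', hh, hk⟩
  refine ⟨S, i, ⟨lfp, fun C hC => ?_⟩, hi, Subtype.range_val⟩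
  obtain ⟨l⟩ := lift C fun c => by
    -- An element of `C` is a map from the free algebra on one generator, so it lies in the image of
    -- a coalgebra with finitely presentable carrier.
    obtain ⟨P, hP, h, g, hg⟩ := hC.exists_factor (isFinitelyPresentable_free (T := T) PUnit)
      (freeExtend (↾fun _ => c))
    obtain ⟨X, hX, e, he⟩ := L.exists_det_cover P (IsFGAlgebra.of_isFinitelyPresentable P.V)
    obtain ⟨t, ht⟩ := he (g.f (T.η.app PUnit PUnit.unit))
    refine ⟨X, hX, t, ?_⟩
    have h₁ : h.f.f (e.f.f t) = c := by
      rw [ht]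
      exact (ConcreteCategory.congr_hom (congrArg Monad.Algebra.Hom.f hg) _).trans
        (unit_freeExtend_apply _ PUnit.unit)
    rw [← h₁]
    exact ((L.behaviour_apply hZ h _).trans (L.behaviour_apply hZ e t)).symm
  exact ⟨l, fun _ => uniq _ _⟩

end Lifting

theorem IsRationalFixpoint.exists_embedding {T : CategoryTheory.Monad (Type u)}
    {F : Type u ⥤ Type u} (L : Lifting T F) [PreservesFilteredColimits T.toFunctor]
    (hF : ∀ {X Y : Type u} (f : X ⟶ Y), Function.Injective f → Function.Injective (F.map f))
    (hker : FGClosedUnderKernelPairs T) {Z : Coalgebra F} (hZ : IsTerminal Z)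
    {S : Coalgebra L.functor} (hS : IsRationalFixpoint S) :
    ∃ i : S ⟶ L.finalCoalgebra hZ, Function.Injective i.f.f ∧
      Set.range i.f.f = L.rationalSet hZ := by
  obtain ⟨S', i, hS', hi, hr⟩ := L.exists_rationalFixpoint hF hker hZ
  obtain ⟨e⟩ := hS.nonempty_iso hS'
  have h₁ : ∀ x, e.inv.f.f (e.hom.f.f x) = x := fun x => ConcreteCategory.congr_hom
    (congrArg Monad.Algebra.Hom.f (congrArg Coalgebra.Hom.f e.hom_inv_id)) x
  have h₂ : ∀ x, e.hom.f.f (e.inv.f.f x) = x := fun x => ConcreteCategory.congr_hom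
    (congrArg Monad.Algebra.Hom.f (congrArg Coalgebra.Hom.f e.inv_hom_id)) x
  refine ⟨e.hom ≫ i, hi.comp (Function.LeftInverse.injective h₁), ?_⟩
  rw [← hr]
  exact Function.Surjective.range_comp (Function.RightInverse.surjective h₂) i.f.f

/-! ### The language map of a fixpoint of `FT`, and the main theorem -/

namespace Lifting

variable {T : CategoryTheory.Monad (Type u)} {F : Type u ⥤ Type u} (L : Lifting T F)

/-- The algebra structure of a fixpoint of `FT` as a coalgebra homomorphism. -/
noncomputable def detToFixpoint (R : Coalgebra (T.toFunctor ⋙ F)) [IsIso R.str] :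
    L.det R ⟶ L.fixpointCoalgebra R where
  f := { f := (L.fixpointCoalgebra R).V.a, h := (L.fixpointCoalgebra R).V.assoc.symm }
  h := by
    apply Monad.Algebra.Hom.ext
    change L.ext (X := R.V) R.str ≫ F.map (L.algebraOfIso (X := R.V) (asIso R.str)).a =
      (L.ext (X := R.V) R.str ≫ inv R.str) ≫ R.str ≫
        F.map (L.algebraOfIso (X := R.V) (asIso R.str)).a
    rw [Category.assoc, IsIso.inv_hom_id_assoc]

theorem detToFixpoint_unit (R : Coalgebra (T.toFunctor ⋙ F)) [IsIso R.str] (x : R.V) :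
    (L.detToFixpoint R).f.f (T.η.app R.V x) = x :=
  ConcreteCategory.congr_hom (L.fixpointCoalgebra R).V.unit x

/-- The behaviour of a fixpoint of `FT` is the coalgebraic language map. -/
theorem behaviour_fixpointCoalgebra {Z : Coalgebra F} (hZ : IsTerminal Z)
    (R : Coalgebra (T.toFunctor ⋙ F)) [IsIso R.str] (x : R.V) :
    (L.behaviour hZ (L.fixpointCoalgebra R)).f.f x = L.lang hZ R x := by
  have h := L.behaviour_apply hZ (L.detToFixpoint R) (T.η.app R.V x)
  rw [detToFixpoint_unit] at h
  exact h

theorem lang_hom {Z : Coalgebra F} (hZ : IsTerminal Z) {X R : Coalgebra (T.toFunctor ⋙ F)}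
    (h : X ⟶ R) (x : X.V) : L.lang hZ R (h.f x) = L.lang hZ X x := by
  have h₁ : T.η.app R.V (h.f x) = T.map h.f (T.η.app X.V x) :=
    ConcreteCategory.congr_hom (T.η.naturality h.f) x
  exact (congrArg (L.behaviour hZ (L.det R)).f.f h₁).trans
    (L.behaviour_apply hZ (L.detMap h) (T.η.app X.V x))

end Lifting

theorem theorem4p4 (T : CategoryTheory.Monad (Type u)) (F : Type u ⥤ Type u)
    (hT : PreservesFilteredColimits T.toFunctor) (hF : PreservesFilteredColimits F)
    (hpb : WeaklyPreservesPullbacks F) (hker : FGClosedUnderKernelPairs T) (L : Lifting T F) :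
    (∃ Z : Coalgebra F, Nonempty (IsTerminal Z)) ∧
    (∃ R : Coalgebra (T.toFunctor ⋙ F), IsRationalFixpoint R) ∧
    (∃ S : Coalgebra L.functor, IsRationalFixpoint S) ∧
    ∀ (Z : Coalgebra F) (hZ : IsTerminal Z)
      (R : Coalgebra (T.toFunctor ⋙ F)), IsRationalFixpoint R →
    ∀ S : Coalgebra L.functor, IsRationalFixpoint S →
      ∃ (_ : IsIso R.str) (q : L.fixpointCoalgebra R ⟶ S),
        (∀ q' : L.fixpointCoalgebra R ⟶ S, q' = q) ∧ Function.Surjective q.f.f ∧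
        ∀ (Exp : Type v) (q₀ : Exp → R.V), Function.Surjective q₀ →
          L.IsComplete hZ R q₀ S (fun E => q.f.f (q₀ E)) := by
  have hFinj : ∀ {X Y : Type u} (f : X ⟶ Y), Function.Injective f →
      Function.Injective (F.map f) := fun f hf => hpb.map_injective f hf
  have hFT : ∀ {X Y : Type u} (f : X ⟶ Y), Function.Injective f →
      Function.Injective ((T.toFunctor ⋙ F).map f) := fun f hf => hFinj _ (T.map_injective f hf)
  have : PreservesFilteredColimits (T.toFunctor ⋙ F) := inferInstance
  refine ⟨exists_isTerminal_coalgebra F, ?_, ?_, ?_⟩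
  · obtain ⟨R, hR, -⟩ := exists_rationalFixpoint_type (G := T.toFunctor ⋙ F) hFT
    exact ⟨R, hR⟩
  · obtain ⟨Z, ⟨hZ⟩⟩ := exists_isTerminal_coalgebra F
    obtain ⟨S, -, hS, -⟩ := L.exists_rationalFixpoint hFinj hker hZ
    exact ⟨S, hS⟩
  intro Z hZ R hR S hS
  obtain ⟨hiso, hfin, hcover⟩ := hR.type_properties hFT
  obtain ⟨i, hi, hrange⟩ := hS.exists_embedding L hFinj hker hZ
  -- Each state of `R` comes from a state `x` of a finite `X`, and its behaviour is that of `η x` in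
  -- `TX`, hence rational.
  obtain ⟨q, hq⟩ := L.exists_coalgebraLift hFinj (L.behaviour hZ (L.fixpointCoalgebra R)) i hi
    fun r => by
      obtain ⟨X, hX, h, x, rfl⟩ := hcover r
      rw [← Set.mem_range, hrange]
      refine ⟨X, hX, T.η.app X.V x, ?_⟩
      exact ((L.behaviour_fixpointCoalgebra hZ R (h.f x)).trans (L.lang_hom hZ h x)).symm
  have hq' : ∀ r, i.f.f (q.f.f r) = L.lang hZ R r := fun r =>
    (ConcreteCategory.congr_hom (congrArg Monad.Algebra.Hom.f
      (congrArg Coalgebra.Hom.f hq)) r).trans (L.behaviour_fixpointCoalgebra hZ R r)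
  refine ⟨hiso, q, fun q' => ?_, fun y => ?_, fun Exp q₀ _ E E' hE => ?_⟩
  · apply Coalgebra.ext
    have : Mono i.f := algebra_mono_of_injective _ hi
    rw [← cancel_mono i.f]
    exact congrArg Coalgebra.Hom.f (L.hom_finalCoalgebra_ext hZ (q' ≫ i) (q ≫ i))
  · obtain ⟨X, hX, t, ht⟩ : i.f.f y ∈ L.rationalSet hZ := hrange ▸ ⟨y, rfl⟩
    obtain ⟨h⟩ := hfin X hX
    -- A rational behaviour is that of some `t` in `TX`; the preimage is the image of `t` along `TX
    -- ⟶ TR ⟶ R`.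
    refine ⟨(L.detToFixpoint R).f.f ((L.detMap h).f.f t), hi (Eq.trans ?_ ht)⟩
    exact ConcreteCategory.congr_hom (congrArg Monad.Algebra.Hom.f (congrArg Coalgebra.Hom.f
      (L.hom_finalCoalgebra_ext hZ (L.detMap h ≫ L.detToFixpoint R ≫ q ≫ i)
        (L.behaviour hZ (L.det X))))) t
  · exact hi ((hq' _).trans (hE.trans (hq' _).symm))
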